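/- Let $\mathcal F=(F,<,+,\cdot,0,1,\ldots)$ be an expansion of an ordered field; "definable" means definable in $\mathcal F$ with parameters, $F$ carries the order topology, and $F^n$ the product topology. Assume that $\mathcal F$ is definably complete (every definable subset of $F$ has a supremum and an infimum in $F\cup\{\pm\infty\}$) and locally o-minimal (for every definable $S\subseteq F$ and every $a\in F$ there is an open interval $I\ni a$ such that $S\cap I$ is a finite union of points and open intervals). For a definable continuous map $f:X\to Y$ between definable sets $X\subseteq F^m$ and $Y\subseteq F^n$, call $f$ *definably proper* if for every definable set $C\subseteq Y$ that is closed and bounded in $F^n$, the preimage $f^{-1}(C)$ is closed and bounded in $F^m$; call $f$ *definably identifying* if it is surjective and every definable subset $C\subseteq Y$ for which $f^{-1}(C)$ is closed in $X$ is closed in $Y$. **Lemma.** Let $X\subseteq F^m$ and $Y\subseteq F^n$ be definable sets with $X$ closed in $F^m$, and let $f:X\to Y$ be a definable continuous map. The following are equivalent: 1. $f$ is definably identifying; 2. there is a definable closed subset $K\subseteq X$ such that the restriction $f|_K:K\to Y$ is surjective and definably proper. -/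

import Mathlib

universe u v w

namespace DefinableMaps

section Structure

variable (L : FirstOrder.Language.{u, v}) {F : Type w} [L.Structure F]

/-- Definability with arbitrary parameters of a subset of a Cartesian power of `F`. -/
def IsDef {ι : Type*} (S : Set (ι → F)) : Prop :=
  (Set.univ : Set F).Definable L S

/-- Definability with arbitrary parameters of a subset of `F` itself. -/
def IsDef₁ (S : Set F) : Prop :=
  (Set.univ : Set F).Definable₁ L S

/-- A map between subsets of Cartesian powers is definable if its graph is definable. -/
def IsDefMap {m n : ℕ} {X : Set (Fin m → F)} {Y : Set (Fin n → F)} (f : X → Y) : Prop :=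
  IsDef L {p : Fin m ⊕ Fin n → F | ∃ x : X, p = Sum.elim (x : Fin m → F) (f x : Fin n → F)}

variable (F)

/-- The structure `F` expands the ordered field `F`: the order, the addition and the multiplication
are among its definable relations. This holds in particular when the language has symbols for them;
adding symbols for definable relations does not change the family of definable sets. -/
structure ExpandsOrderedField [Field F] [LinearOrder F] : Prop where
  lt : IsDef L {v : Fin 2 → F | v 0 < v 1}
  add : IsDef L {v : Fin 3 → F | v 0 + v 1 = v 2}
  mul : IsDef L {v : Fin 3 → F | v 0 * v 1 = v 2}

/-- Every definable subset of `F` has a supremum and an infimum in `F ∪ {±∞}`. The value is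
automatically infinite for sets that are empty or unbounded in the direction considered, so the
condition concerns nonempty bounded sets. -/
structure DefinablyComplete [LinearOrder F] : Prop where
  exists_isLUB : ∀ S : Set F, IsDef₁ L S → S.Nonempty → BddAbove S → ∃ a, IsLUB S a
  exists_isGLB : ∀ S : Set F, IsDef₁ L S → S.Nonempty → BddBelow S → ∃ a, IsGLB S a

/-- Around every point, every definable subset of `F` is a finite union of points and open
intervals. -/
def LocallyOMinimal [LinearOrder F] : Prop :=
  ∀ S : Set F, IsDef₁ L S → ∀ a : F, ∃ c d : F, c < a ∧ a < d ∧
    ∃ (P : Finset F) (I : Finset (F × F)),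
      S ∩ Set.Ioo c d = (P : Set F) ∪ ⋃ p ∈ I, Set.Ioo p.1 p.2

end Structure

/-- Boundedness in `F ^ n` for the norm `max |x i|`. -/
def IsBdd {F : Type w} [Field F] [LinearOrder F] {n : ℕ} (S : Set (Fin n → F)) : Prop :=
  ∃ r : F, ∀ x ∈ S, ∀ i, |x i| ≤ r

section Maps

variable (L : FirstOrder.Language.{u, v}) {F : Type w} [L.Structure F] [TopologicalSpace F]
  {m n : ℕ} {X : Set (Fin m → F)} {Y : Set (Fin n → F)}

/-- Preimages of definable sets `K ⊆ Y` that are closed and bounded in `F ^ n` are closed and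
bounded in `F ^ m`. The definition is used for definable continuous maps `f`. -/
def DefinablyProper [Field F] [LinearOrder F] (f : X → Y) : Prop :=
  ∀ K : Set (Fin n → F), K ⊆ Y → IsDef L K → IsClosed K → IsBdd K →
    IsBdd {x : Fin m → F | ∃ hx : x ∈ X, (f ⟨x, hx⟩ : Fin n → F) ∈ K} ∧
    IsClosed {x : Fin m → F | ∃ hx : x ∈ X, (f ⟨x, hx⟩ : Fin n → F) ∈ K}

/-- The map is surjective, and a definable `K ⊆ Y` is closed in `Y` whenever its preimage is closed
in `X`. The definition is used for definable continuous maps `f`. -/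
def DefinablyIdentifying (f : X → Y) : Prop :=
  Function.Surjective f ∧
  ∀ K : Set (Fin n → F), K ⊆ Y → IsDef L K →
    IsClosed {x : X | (f x : Fin n → F) ∈ K} → IsClosed {y : Y | (y : Fin n → F) ∈ K}

end Maps

end DefinableMaps

namespace DefinableMaps

open Set Filter Topology

/-! ### Definability with parameters: connectives, quantifiers, substitution. -/

section Calculus

variable {L : FirstOrder.Language.{u, v}} {F : Type w} [L.Structure F]
  {ι : Type*} {κ : Type*} [Finite κ]

/-! Definable completeness replaces compactness: a decreasing definable family of nonempty bounded
sets has a cluster point (`exists_cluster`). Hence norms attain minima on nonempty closed definable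
sets (`exists_nrm_le`), and continuous definable images of closed bounded definable sets are closed
(`isClosed_image`). Since `K` is closed, properness of `f` on `K` amounts to boundedness of the
preimages of closed bounded sets.

From 2 to 1 (`mem_of_mem_closure_of_proper`): let `C` have closed preimage `S` in `K`, and let `y ∈
Y` be a limit of `C`. Keep the points of `S` with image within 1 of `y` whose norm is at most that
of every point of `S` mapped strictly nearer to `y`. This closed set `N` still has images
arbitrarily near `y`, but its part mapped away from `y` is bounded. So `{y} ∪ f(N)` is closed and
bounded, properness bounds `N`, hence `f(N)` is closed and contains `y`.

From 1 to 2 (`exists_proper_of_identifying`): `K` is the closure of the set of points of least norm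
in their fibres. What is needed is that this least norm is locally bounded on `Y`
(`exists_locally_bounded_of_identifying`). If it were not so at `y`, definable choice would give a
curve `c t → y` as `t → 0`, continuous on some `(0, ε]`, all preimages of `c t` having norm above
`1/t`. Near a given point of `X` only parameters bounded away from 0 then occur, so `c((0, ε])` has
closed preimage; yet it accumulates at `y` without containing it.

Local o-minimality enters through germs: a definable subset of `F` contains or misses an interval to
the right of each point. This yields choice and the eventual continuity of bounded definable
functions. -/

theorem IsDef.and {P Q : (ι → F) → Prop} (hP : IsDef L {v | P v}) (hQ : IsDef L {v | Q v}) :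
    IsDef L {v | P v ∧ Q v} :=
  Set.Definable.inter hP hQ

theorem IsDef.or {P Q : (ι → F) → Prop} (hP : IsDef L {v | P v}) (hQ : IsDef L {v | Q v}) :
    IsDef L {v | P v ∨ Q v} :=
  Set.Definable.union hP hQ

theorem IsDef.not {P : (ι → F) → Prop} (hP : IsDef L {v | P v}) : IsDef L {v | ¬ P v} :=
  Set.Definable.compl hP

theorem IsDef.imp {P Q : (ι → F) → Prop} (hP : IsDef L {v | P v}) (hQ : IsDef L {v | Q v}) :
    IsDef L {v | P v → Q v} := by
  simpa only [imp_iff_not_or] using hP.not.or hQ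

theorem IsDef.prop (p : Prop) : IsDef L {_v : ι → F | p} := by
  by_cases hp : p
  · convert! (Set.definable_univ : (Set.univ : Set F).Definable L (Set.univ : Set (ι → F)))
    simp [hp]
  · convert! (Set.definable_empty : (Set.univ : Set F).Definable L (∅ : Set (ι → F)))
    simp [hp]

theorem IsDef.exVec {P : (ι → F) → (κ → F) → Prop}
    (h : IsDef L {w : ι ⊕ κ → F | P (fun i => w (Sum.inl i)) (fun j => w (Sum.inr j))}) :
    IsDef L {v | ∃ x, P v x} :=
  Set.Definable.exists_of_finite h

theorem IsDef.allVec {P : (ι → F) → (κ → F) → Prop}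
    (h : IsDef L {w : ι ⊕ κ → F | P (fun i => w (Sum.inl i)) (fun j => w (Sum.inr j))}) :
    IsDef L {v | ∀ x, P v x} :=
  Set.Definable.forall_of_finite h

theorem IsDef.ex {P : (ι → F) → F → Prop}
    (h : IsDef L {w : ι ⊕ Fin 1 → F | P (fun i => w (Sum.inl i)) (w (Sum.inr 0))}) :
    IsDef L {v | ∃ t, P v t} := by
  have := IsDef.exVec (P := fun v x => P v (x 0)) h
  convert this using 3
  exact ⟨fun ⟨t, ht⟩ => ⟨fun _ => t, ht⟩, fun ⟨x, hx⟩ => ⟨x 0, hx⟩⟩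

theorem IsDef.all {P : (ι → F) → F → Prop}
    (h : IsDef L {w : ι ⊕ Fin 1 → F | P (fun i => w (Sum.inl i)) (w (Sum.inr 0))}) :
    IsDef L {v | ∀ t, P v t} := by
  have := IsDef.allVec (P := fun v x => P v (x 0)) h
  convert this using 3
  exact ⟨fun h x => h (x 0), fun h t => h fun _ => t⟩

theorem IsDef.finAll {P : κ → (ι → F) → Prop}
    (h : ∀ i, IsDef L {v | P i v}) : IsDef L {v | ∀ i, P i v} := by
  have := Set.definable_iInter_of_finite h
  convert! this using 1
  ext
  simp

variable (L) in
/-- A function on a Cartesian power is definable if its graph is definable. -/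
def DefFun (g : (ι → F) → F) : Prop :=
  IsDef L {w : ι ⊕ Fin 1 → F | g (fun i => w (Sum.inl i)) = w (Sum.inr 0)}

theorem isDef_var_eq (i j : ι) : IsDef L {v : ι → F | v i = v j} :=
  ⟨(FirstOrder.Language.Term.var i).equal (FirstOrder.Language.Term.var j), by
    ext; simp⟩

theorem DefFun.var (i : ι) : DefFun L fun v : ι → F => v i :=
  isDef_var_eq _ _

theorem DefFun.const (c : F) : DefFun L fun _ : ι → F => c := by
  have h : IsDef L {x : Fin 1 → F | x 0 = c} := Set.Definable.singleton_of_mem L (Set.mem_univ c)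
  have := h.preimage_comp (fun i : Fin 1 => (Sum.inr i : ι ⊕ Fin 1))
  unfold DefFun
  simp_rw [eq_comm (a := c)]
  exact this

/-- Each quantifier adjoins variables on the right of the index sum; functions of the old variables
are reread in this larger context. -/
theorem DefFun.weaken {g : (ι → F) → F} (hg : DefFun L g) (μ : Type*) :
    DefFun L fun w : ι ⊕ μ → F => g fun i => w (Sum.inl i) :=
  hg.preimage_comp (fun i : ι ⊕ Fin 1 =>
    (i.elim (fun i => Sum.inl (Sum.inl i)) Sum.inr : (ι ⊕ μ) ⊕ Fin 1))

theorem DefFun.eq_var {g : (ι → F) → F} (hg : DefFun L g) (j : ι) :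
    IsDef L {v | g v = v j} :=
  hg.preimage_comp (fun i : ι ⊕ Fin 1 => (i.elim id fun _ => j : ι))

/-- Substitution: quantify existentially over the vector of values of `g`, so that only graphs and
`S` occur. -/
theorem IsDef.mem {S : Set (κ → F)} (hS : IsDef L S) {g : (ι → F) → κ → F}
    (hg : ∀ i, DefFun L fun v => g v i) : IsDef L {v | g v ∈ S} := by
  have : IsDef L {v : ι → F | ∃ x : κ → F, (∀ i, g v i = x i) ∧ x ∈ S} := by
    refine .exVec (.and (.finAll fun i => ?_) ?_)
    · exact ((hg i).weaken (κ)).eq_var (Sum.inr i)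
    · exact hS.preimage_comp Sum.inr
  convert this using 3 with v
  exact ⟨fun h => ⟨g v, fun _ => rfl, h⟩, fun ⟨x, hx, h⟩ => by rwa [funext hx]⟩

theorem IsDef.eq {g h : (ι → F) → F} (hg : DefFun L g) (hh : DefFun L h) :
    IsDef L {v | g v = h v} := by
  have := IsDef.mem (isDef_var_eq (L := L) (F := F) (0 : Fin 2) 1) (g := fun v => ![g v, h v])
    (fun i => by fin_cases i; exacts [hg, hh])
  exact this

/-- Composition of a definable function with definable functions. -/
theorem DefFun.comp {g : (κ → F) → F} (hg : DefFun L g) {h : (ι → F) → κ → F}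
    (hh : ∀ i, DefFun L fun v => h v i) : DefFun L fun v => g (h v) := by
  have : IsDef L {w : ι ⊕ Fin 1 → F | ∃ x : κ → F,
      (∀ i, h (fun i => w (Sum.inl i)) i = x i) ∧ g x = w (Sum.inr 0)} := by
    refine .exVec (.and (.finAll fun i => ?_) ?_)
    · exact (((hh i).weaken (Fin 1)).weaken (κ)).eq_var (Sum.inr i)
    · exact hg.preimage_comp (fun i : κ ⊕ Fin 1 =>
        (i.elim Sum.inr fun i => Sum.inl (Sum.inr i) : (ι ⊕ Fin 1) ⊕ κ))
  unfold DefFun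
  convert this using 3 with w
  exact ⟨fun e => ⟨_, fun _ => rfl, e⟩, fun ⟨x, hx, e⟩ => by rwa [← funext hx] at e⟩

/-- Composition of a definable unary function with a definable function. -/
theorem DefFun.comp₁ {g : F → F} (hg : DefFun L fun x : Fin 1 → F => g (x 0)) {h : (ι → F) → F}
    (hh : DefFun L h) : DefFun L fun v => g (h v) :=
  hg.comp (h := fun v _ => h v) fun _ => hh

theorem IsDef.mem₁ {S : Set F} (hS : IsDef₁ L S) {h : (ι → F) → F}
    (hh : DefFun L h) : IsDef L {v | h v ∈ S} :=
  IsDef.mem hS (g := fun v _ => h v) fun _ => hh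

theorem isDef₁_iff {P : F → Prop} : IsDef₁ L {t | P t} ↔ IsDef L {x : Fin 1 → F | P (x 0)} :=
  Iff.rfl

/-- A function with a definable graph is definable. -/
theorem DefFun.of_iff {g : (ι → F) → F} {R : (ι → F) → F → Prop} (h : ∀ v t, g v = t ↔ R v t)
    (hR : IsDef L {w : ι ⊕ Fin 1 → F | R (fun i => w (Sum.inl i)) (w (Sum.inr 0))}) :
    DefFun L g := by
  unfold DefFun
  simpa only [h] using hR

/-! ### Order, arithmetic and the maximum norm. -/

section Field

variable [Field F] [LinearOrder F]

theorem IsDef.lt (hexp : ExpandsOrderedField L F) {g h : (ι → F) → F} (hg : DefFun L g)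
    (hh : DefFun L h) : IsDef L {v | g v < h v} :=
  IsDef.mem hexp.lt (g := fun v => ![g v, h v]) (fun i => by fin_cases i; exacts [hg, hh])

theorem IsDef.le (hexp : ExpandsOrderedField L F) {g h : (ι → F) → F} (hg : DefFun L g)
    (hh : DefFun L h) : IsDef L {v | g v ≤ h v} := by
  simpa only [not_lt] using (IsDef.lt hexp hh hg).not

theorem DefFun.add (hexp : ExpandsOrderedField L F) {g h : (ι → F) → F} (hg : DefFun L g)
    (hh : DefFun L h) : DefFun L fun v => g v + h v :=
  IsDef.mem hexp.add (g := fun w : ι ⊕ Fin 1 → F =>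
    ![g fun i => w (Sum.inl i), h fun i => w (Sum.inl i), w (Sum.inr 0)])
    (fun i => by fin_cases i; exacts [hg.weaken _, hh.weaken _, .var _])

theorem DefFun.mul (hexp : ExpandsOrderedField L F) {g h : (ι → F) → F} (hg : DefFun L g)
    (hh : DefFun L h) : DefFun L fun v => g v * h v :=
  IsDef.mem hexp.mul (g := fun w : ι ⊕ Fin 1 → F =>
    ![g fun i => w (Sum.inl i), h fun i => w (Sum.inl i), w (Sum.inr 0)])
    (fun i => by fin_cases i; exacts [hg.weaken _, hh.weaken _, .var _])

theorem DefFun.sub (hexp : ExpandsOrderedField L F) {g h : (ι → F) → F} (hg : DefFun L g)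
    (hh : DefFun L h) : DefFun L fun v => g v - h v :=
  .of_iff (fun _ _ => sub_eq_iff_eq_add)
    (.eq (hg.weaken _) (.add hexp (.var _) (hh.weaken _)))

theorem DefFun.abs (hexp : ExpandsOrderedField L F) {g : (ι → F) → F} (hg : DefFun L g) :
    DefFun L fun v => |g v| := by
  refine .of_iff (R := fun v t => (g v = t ∨ 0 - g v = t) ∧ g v ≤ t ∧ 0 - g v ≤ t) (fun v t => ?_) ?_
  · constructor
    · rintro rfl
      simp only [zero_sub]
      exact ⟨(abs_choice (g v)).imp Eq.symm Eq.symm, le_abs_self _, neg_le_abs _⟩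
    · rintro ⟨h | h, h1, h2⟩
      · exact le_antisymm (abs_le'.2 ⟨h1, by simpa using h2⟩) (h ▸ le_abs_self _)
      · exact le_antisymm (abs_le'.2 ⟨h1, by simpa using h2⟩) (h ▸ by simpa using neg_le_abs _)
  · have hg' := hg.weaken (Fin 1)
    have h0 := DefFun.sub hexp (.const 0) hg'
    exact .and (.or (.eq hg' (.var _)) (.eq h0 (.var _)))
      (.and (.le hexp hg' (.var _)) (.le hexp h0 (.var _)))

/-- The maximum norm on a Cartesian power. -/
def nrm {n : ℕ} (x : Fin n → F) : F :=
  (Finset.univ : Finset (Option (Fin n))).sup' Finset.univ_nonempty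
    fun o => o.elim 0 fun i => |x i|

variable {n : ℕ} {x y z : Fin n → F} {r : F}

/-- The condition `0 ≤ r` comes from the index `none`, which keeps the maximum meaningful for `n =
0`. -/
theorem nrm_le : nrm x ≤ r ↔ 0 ≤ r ∧ ∀ i, |x i| ≤ r := by
  rw [nrm, Finset.sup'_le_iff]
  simp [Option.forall]

theorem nrm_lt : nrm x < r ↔ 0 < r ∧ ∀ i, |x i| < r := by
  rw [nrm, Finset.sup'_lt_iff]
  simp [Option.forall]

theorem nrm_nonneg : 0 ≤ nrm x := (nrm_le.1 le_rfl).1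

theorem abs_le_nrm (i : Fin n) : |x i| ≤ nrm x := (nrm_le.1 le_rfl).2 i

theorem DefFun.nrm (hexp : ExpandsOrderedField L F) {g : (ι → F) → Fin n → F}
    (hg : ∀ i, DefFun L fun v => g v i) : DefFun L fun v => nrm (g v) := by
  refine .of_iff (R := fun v t => (0 ≤ t ∧ ∀ i, |g v i| ≤ t) ∧ ¬ (0 < t ∧ ∀ i, |g v i| < t))
    (fun v t => ?_) ?_
  · rw [← nrm_le, ← nrm_lt, not_lt, le_antisymm_iff]
  · have hg' := fun i => ((hg i).weaken (Fin 1)).abs hexp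
    exact .and (.and (.le hexp (.const _) (.var _)) (.finAll fun i => .le hexp (hg' i) (.var _)))
      (.not (.and (.lt hexp (.const _) (.var _)) (.finAll fun i => .lt hexp (hg' i) (.var _))))

theorem nrm_sub_comm : nrm (x - y) = nrm (y - x) := by
  simp [nrm, abs_sub_comm]

theorem isBdd_iff {S : Set (Fin n → F)} : IsBdd S ↔ ∃ r, ∀ x ∈ S, nrm x ≤ r := by
  constructor
  · rintro ⟨r, hr⟩
    exact ⟨max r 0, fun x hx => nrm_le.2 ⟨le_max_right _ _, fun i =>
      (hr x hx i).trans (le_max_left _ _)⟩⟩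
  · rintro ⟨r, hr⟩
    exact ⟨r, fun x hx i => (abs_le_nrm i).trans (hr x hx)⟩

variable [IsStrictOrderedRing F]

theorem nrm_eq_zero : nrm x = 0 ↔ x = 0 := by
  rw [← nrm_nonneg.ge_iff_eq', nrm_le]
  simp [funext_iff]

theorem nrm_sub_self : nrm (x - x) = 0 := by
  rw [nrm_eq_zero, sub_self]

theorem nrm_sub_pos : 0 < nrm (x - y) ↔ x ≠ y := by
  rw [nrm_nonneg.lt_iff_ne', ne_eq, nrm_eq_zero, sub_eq_zero]

theorem nrm_sub_le (x y z : Fin n → F) : nrm (x - z) ≤ nrm (x - y) + nrm (y - z) :=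
  nrm_le.2 ⟨add_nonneg nrm_nonneg nrm_nonneg, fun i =>
    (abs_sub_le (x i) (y i) (z i)).trans
      (add_le_add (abs_le_nrm (x := x - y) i) (abs_le_nrm (x := y - z) i))⟩

theorem nrm_le_add (x y : Fin n → F) : nrm x ≤ nrm (x - y) + nrm y := by
  simpa using nrm_sub_le x y 0

variable [TopologicalSpace F] [OrderTopology F]

theorem nhds_basis_nrm (a : Fin n → F) :
    (nhds a).HasBasis (fun ε : F => 0 < ε) fun ε => {x | nrm (x - a) < ε} := by
  rw [nhds_pi]
  have h := Filter.hasBasis_pi fun i : Fin n => nhds_basis_abs_sub_lt (a i)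
  refine h.to_hasBasis ?_ ?_
  · rintro ⟨I, ε⟩ ⟨-, hε⟩
    have : ∃ δ > 0, ∀ i ∈ I, δ ≤ ε i := by
      classical
      have hI : I.Finite := Set.toFinite I
      induction I, hI using Set.Finite.induction_on with
      | empty => exact ⟨1, one_pos, by simp⟩
      | insert _ _ ih =>
        obtain ⟨δ, hδ, h⟩ := ih fun i hi => hε i (Or.inr hi)
        exact ⟨min δ _, lt_min hδ (hε _ (Or.inl rfl)), by
          rintro i (rfl | hi)
          · exact min_le_right _ _
          · exact (min_le_left _ _).trans (h i hi)⟩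
    obtain ⟨δ, hδ, h⟩ := this
    exact ⟨δ, hδ, fun x hx i hi => ((nrm_lt.1 hx).2 i).trans_le (h i hi)⟩
  · intro ε hε
    refine ⟨⟨Set.univ, fun _ => ε⟩, ⟨Set.toFinite _, fun _ _ => hε⟩, fun x hx => ?_⟩
    exact nrm_lt.2 ⟨hε, fun i => hx i (Set.mem_univ i)⟩

theorem mem_closure_iff_nrm {S : Set (Fin n → F)} {a : Fin n → F} :
    a ∈ closure S ↔ ∀ ε > 0, ∃ x ∈ S, nrm (x - a) < ε := by
  rw [mem_closure_iff_nhds_basis (nhds_basis_nrm a)]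
  rfl

theorem isClosed_iff_nrm {S : Set (Fin n → F)} :
    IsClosed S ↔ ∀ a, (∀ ε > 0, ∃ x ∈ S, nrm (x - a) < ε) → a ∈ S := by
  rw [← closure_subset_iff_isClosed]
  simp [Set.subset_def, mem_closure_iff_nrm]

theorem continuousOn_iff_nrm {m : ℕ} {g : (Fin m → F) → Fin n → F} {S : Set (Fin m → F)} :
    ContinuousOn g S ↔ ∀ a ∈ S, ∀ ε > 0, ∃ δ > 0, ∀ x ∈ S, nrm (x - a) < δ →
      nrm (g x - g a) < ε := by
  refine forall₂_congr fun a _ => ?_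
  rw [ContinuousWithinAt, nhdsWithin,
    (((nhds_basis_nrm a).inf_principal S).tendsto_iff (nhds_basis_nrm (g a)))]
  simp only [Set.mem_inter_iff, and_imp]
  exact forall₂_congr fun ε _ => exists_congr fun δ => and_congr_right fun _ =>
    ⟨fun h x hx hd => h x hd hx, fun h x hd hx => h x hx hd⟩

end Field

end Calculus

/-! ### Definable compactness. -/

section Compactness

variable {L : FirstOrder.Language.{u, v}} {F : Type w} [L.Structure F] {m n : ℕ}

variable (L) in
/-- A definable family of subsets of `F ^ n` indexed by `F`. -/
def DefFamily (A : F → Set (Fin n → F)) : Prop :=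
  IsDef L {w : Fin 1 ⊕ Fin n → F | (fun j => w (Sum.inr j)) ∈ A (w (Sum.inl 0))}

theorem DefFamily.mem {A : F → Set (Fin n → F)} (hA : DefFamily L A) {ι : Type*}
    {t : (ι → F) → F} {g : (ι → F) → Fin n → F} (ht : DefFun L t)
    (hg : ∀ i, DefFun L fun v => g v i) : IsDef L {v | g v ∈ A (t v)} :=
  IsDef.mem hA (g := fun v => Sum.elim (fun _ => t v) (g v)) <| by
    rintro (i | i)
    exacts [ht, hg i]

variable [Field F] [LinearOrder F] [IsStrictOrderedRing F]

/-- The coordinates of the cluster point are found one at a time, each as a lower limit along points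
already close to it in the earlier coordinates. -/
theorem exists_cluster_finset (hexp : ExpandsOrderedField L F) (hcomplete : DefinablyComplete L F)
    {A : F → Set (Fin n → F)} (hA : DefFamily L A)
    (hmono : ∀ s t, 0 < s → s ≤ t → A s ⊆ A t) (hne : ∀ t > 0, (A t).Nonempty)
    {t₀ : F} (ht₀ : 0 < t₀) (hbdd : IsBdd (A t₀)) (s : Finset (Fin n)) :
    ∃ x : Fin n → F, ∀ t > 0, ∃ a ∈ A t, ∀ i ∈ s, |a i - x i| < t := by
  classical
  induction s using Finset.induction_on with
  | empty => exact ⟨0, fun t ht => (hne t ht).imp fun a ha => ⟨ha, by simp⟩⟩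
  | insert i s hi ih =>
    obtain ⟨x, hx⟩ := ih
    obtain ⟨r, hr⟩ := hbdd
    -- The supremum of `G` is the lower limit, as `t → 0`, of coordinate `i` on the points of `A t`
    -- within `t` of `x` in the coordinates from `s`.
    let G : Set F := {v | ∃ t, 0 < t ∧ ∀ a : Fin n → F,
      (a ∈ A t ∧ ∀ j, j ∈ s → |a j - x j| < t) → v ≤ a i}
    have hG : IsDef₁ L G := by
      refine isDef₁_iff.2 (.ex (.and (.lt hexp (.const _) (.var _)) (.allVec (.imp (.and
        (hA.mem (.var _) fun _ => .var _) (.finAll fun j => .imp (.prop _) ?_)) ?_))))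
      · exact .lt hexp (.abs hexp (.sub hexp (.var _) (.const _))) (.var _)
      · exact .le hexp (.var _) (.var _)
    have hG1 : -r ∈ G := ⟨t₀, ht₀, fun a ha => (abs_le.1 (hr a ha.1 i)).1⟩
    have hG2 : BddAbove G := by
      refine ⟨r, ?_⟩
      rintro v ⟨t, ht, hv⟩
      obtain ⟨a, ha, ha'⟩ := hx (min t t₀) (lt_min ht ht₀)
      have h1 := hv a ⟨hmono _ _ (lt_min ht ht₀) (min_le_left _ _) ha,
        fun j hj => (ha' j hj).trans_le (min_le_left _ _)⟩
      exact h1.trans (abs_le.1 (hr a (hmono _ _ (lt_min ht ht₀) (min_le_right _ _) ha) i)).2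
    obtain ⟨l, hl⟩ := hcomplete.exists_isLUB G hG ⟨_, hG1⟩ hG2
    refine ⟨Function.update x i l, fun t ht => ?_⟩
    obtain ⟨v, ⟨t₁, ht₁, hv⟩, hlv, -⟩ := hl.exists_between (sub_lt_self l ht)
    have ht₂ : 0 < min t t₁ := lt_min ht ht₁
    have hnot : l + t / 2 ∉ G := fun h => by
      have := hl.1 h
      linarith
    obtain ⟨a, ⟨ha, ha'⟩, hai⟩ : ∃ a : Fin n → F,
        (a ∈ A (min t t₁) ∧ ∀ j, j ∈ s → |a j - x j| < min t t₁) ∧ a i < l + t / 2 := by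
      by_contra! hcon
      exact hnot ⟨_, ht₂, hcon⟩
    have h1 := hv a ⟨hmono _ _ ht₂ (min_le_right _ _) ha,
      fun j hj => (ha' j hj).trans_le (min_le_right _ _)⟩
    refine ⟨a, hmono _ _ ht₂ (min_le_left _ _) ha, fun j hj => ?_⟩
    rcases Finset.mem_insert.1 hj with rfl | hj
    · rw [Function.update_self, abs_lt]
      constructor <;> linarith
    · rw [Function.update_of_ne (by rintro rfl; contradiction)]
      exact (ha' j hj).trans_le (min_le_left _ _)

/-- A definable decreasing family of nonempty bounded sets has a cluster point. -/
theorem exists_cluster (hexp : ExpandsOrderedField L F) (hcomplete : DefinablyComplete L F)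
    {A : F → Set (Fin n → F)} (hA : DefFamily L A)
    (hmono : ∀ s t, 0 < s → s ≤ t → A s ⊆ A t) (hne : ∀ t > 0, (A t).Nonempty)
    {t₀ : F} (ht₀ : 0 < t₀) (hbdd : IsBdd (A t₀)) :
    ∃ x : Fin n → F, ∀ t > 0, ∃ a ∈ A t, nrm (a - x) < t := by
  obtain ⟨x, hx⟩ := exists_cluster_finset hexp hcomplete hA hmono hne ht₀ hbdd Finset.univ
  refine ⟨x, fun t ht => ?_⟩
  obtain ⟨a, ha, h⟩ := hx t ht
  exact ⟨a, ha, nrm_lt.2 ⟨ht, fun i => h i (Finset.mem_univ i)⟩⟩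

variable [TopologicalSpace F] [OrderTopology F]

theorem exists_cluster_mem (hexp : ExpandsOrderedField L F) (hcomplete : DefinablyComplete L F)
    {A : F → Set (Fin n → F)} (hA : DefFamily L A)
    (hmono : ∀ s t, 0 < s → s ≤ t → A s ⊆ A t) (hne : ∀ t > 0, (A t).Nonempty)
    {t₀ : F} (ht₀ : 0 < t₀) (hbdd : IsBdd (A t₀)) {S : Set (Fin n → F)} (hS : IsClosed S)
    (hAS : ∀ t > 0, A t ⊆ S) :
    ∃ x ∈ S, ∀ t > 0, ∃ a ∈ A t, nrm (a - x) < t := by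
  obtain ⟨x, hx⟩ := exists_cluster hexp hcomplete hA hmono hne ht₀ hbdd
  refine ⟨x, isClosed_iff_nrm.1 hS x fun ε hε => ?_, hx⟩
  obtain ⟨a, ha, h⟩ := hx ε hε
  exact ⟨a, hAS ε hε ha, h⟩

/-- For a limit `y` of the image, the preimages of shrinking balls about `y` cluster at a point of
`S`, which `g` sends to `y` by continuity. -/
theorem isClosed_image (hexp : ExpandsOrderedField L F) (hcomplete : DefinablyComplete L F)
    {S : Set (Fin m → F)} (hS : IsDef L S) (hclosed : IsClosed S) (hbdd : IsBdd S)
    {g : (Fin m → F) → Fin n → F} (hg : ∀ i, DefFun L fun x => g x i) (hcont : ContinuousOn g S) :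
    IsClosed (g '' S) := by
  refine isClosed_iff_nrm.2 fun y hy => ?_
  let A : F → Set (Fin m → F) := fun t => {x | x ∈ S ∧ nrm (g x - y) < t}
  have hA : DefFamily L A := by
    refine .and (hS.mem fun _ => .var _) (.lt hexp (.nrm hexp fun i => .sub hexp ?_ (.const _))
      (.var _))
    exact (hg i).comp fun _ => .var _
  obtain ⟨x, hxS, hx⟩ := exists_cluster_mem hexp hcomplete hA
    (fun s t _ hst x hx => ⟨hx.1, hx.2.trans_le hst⟩)
    (fun t ht => by
      obtain ⟨_, ⟨x, hx, rfl⟩, h⟩ := hy t ht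
      exact ⟨x, hx, h⟩)
    one_pos (isBdd_iff.2 ((isBdd_iff.1 hbdd).imp fun r hr x hx => hr x hx.1)) hclosed
    (fun t _ x hx => hx.1)
  refine ⟨x, hxS, ?_⟩
  by_contra hne
  have hpos := nrm_sub_pos.2 hne
  obtain ⟨δ, hδ, h⟩ := continuousOn_iff_nrm.1 hcont x hxS _ (half_pos hpos)
  obtain ⟨a, ⟨haS, ha⟩, hax⟩ := hx (min δ (nrm (g x - y) / 2)) (lt_min hδ (half_pos hpos))
  have h1 := h a haS (hax.trans_le (min_le_left _ _))
  have h2 := ha.trans_le (min_le_right _ _)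
  have h3 := nrm_sub_le (g x) (g a) y
  rw [nrm_sub_comm] at h1
  linarith

theorem exists_nrm_le (hexp : ExpandsOrderedField L F) (hcomplete : DefinablyComplete L F)
    {S : Set (Fin m → F)} (hS : IsDef L S) (hclosed : IsClosed S) (hne : S.Nonempty) :
    ∃ x ∈ S, ∀ x' ∈ S, nrm x ≤ nrm x' := by
  have hR : IsDef₁ L {t : F | ∃ x : Fin m → F, x ∈ S ∧ nrm x = t} :=
    isDef₁_iff.2 (.exVec (.and (hS.mem fun _ => .var _) (.eq (.nrm hexp fun _ => .var _) (.var _))))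
  obtain ⟨r, hr⟩ := hcomplete.exists_isGLB _ hR (hne.imp' nrm fun x hx => ⟨x, hx, rfl⟩)
    ⟨0, by rintro _ ⟨x, -, rfl⟩; exact nrm_nonneg⟩
  let A : F → Set (Fin m → F) := fun t => {x | x ∈ S ∧ nrm x < r + t}
  have hA : DefFamily L A := .and (hS.mem fun _ => .var _)
    (.lt hexp (.nrm hexp fun i => .var _) (.add hexp (.const _) (.var _)))
  obtain ⟨x, hxS, hx⟩ := exists_cluster_mem hexp hcomplete hA
    (fun s t _ hst x hx => ⟨hx.1, hx.2.trans_le (by gcongr)⟩)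
    (fun t ht => by
      obtain ⟨_, ⟨x, hx, rfl⟩, -, h⟩ := hr.exists_between (lt_add_of_pos_right r ht)
      exact ⟨x, hx, h⟩)
    one_pos (isBdd_iff.2 ⟨r + 1, fun x hx => hx.2.le⟩) hclosed (fun t _ x hx => hx.1)
  refine ⟨x, hxS, fun x' hx' => le_trans ?_ (hr.1 ⟨x', hx', rfl⟩)⟩
  refine le_of_forall_pos_le_add fun ε hε => ?_
  obtain ⟨a, ⟨-, ha⟩, hax⟩ := hx (ε / 2) (half_pos hε)
  have := nrm_le_add x a
  rw [nrm_sub_comm] at hax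
  linarith

/-! ### From proper to identifying. -/

theorem continuous_nrm : Continuous (nrm : (Fin n → F) → F) := by
  unfold nrm
  refine Continuous.finset_sup'_apply _ fun o _ => ?_
  cases o with
  | none => exact continuous_const
  | some i => exact (continuous_apply i).abs

/-- Proper maps satisfy the closedness condition of identifying maps. -/
theorem mem_of_mem_closure_of_proper (hexp : ExpandsOrderedField L F)
    (hcomplete : DefinablyComplete L F) {K : Set (Fin m → F)} {Y : Set (Fin n → F)}
    (hK : IsDef L K) {g : (Fin m → F) → Fin n → F} (hg : ∀ i, DefFun L fun x => g x i)
    (hcont : ContinuousOn g K) (hmaps : MapsTo g K Y) (hsurj : SurjOn g K Y)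
    (hproper : ∀ B ⊆ Y, IsDef L B → IsClosed B → IsBdd B → IsBdd {x | x ∈ K ∧ g x ∈ B})
    {C : Set (Fin n → F)} (hCY : C ⊆ Y) (hC : IsDef L C) (hclosed : IsClosed {x | x ∈ K ∧ g x ∈ C})
    {y : Fin n → F} (hyY : y ∈ Y) (hy : y ∈ closure C) : y ∈ C := by
  by_contra hyC
  set S : Set (Fin m → F) := {x | x ∈ K ∧ g x ∈ C} with hSdef
  have hgy : ∀ {ι : Type} {h : (ι → F) → Fin m → F}, (∀ i, DefFun L fun v => h v i) →
      DefFun L fun v => nrm (g (h v) - y) := fun hh =>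
    .nrm hexp fun i => .sub hexp ((hg i).comp hh) (.const _)
  have hS : IsDef L S := .and hK (hC.mem hg)
  have hScont : ContinuousOn g S := hcont.mono fun x hx => hx.1
  have hdcont : ContinuousOn (fun x => nrm (g x - y)) S :=
    continuous_nrm.comp_continuousOn (hScont.sub continuousOn_const)
  -- `N` plays the role of a curve in `S` whose image tends to `y`: a point is kept when no point of
  -- `S` mapped strictly nearer to `y` has smaller norm.
  set N : Set (Fin m → F) := {x | (x ∈ S ∧ nrm (g x - y) ≤ 1) ∧
    ∀ x' : Fin m → F, x' ∈ S → nrm (g x' - y) < nrm (g x - y) → nrm x ≤ nrm x'} with hNdef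
  have hN : IsDef L N := by
    refine .and (.and hS (.le hexp (hgy fun i => .var i) (.const _))) (.allVec ?_)
    exact .imp (hS.mem fun _ => .var _) (.imp (.lt hexp (hgy fun _ => .var _) (hgy fun _ => .var _))
      (.le hexp (.nrm hexp fun _ => .var _) (.nrm hexp fun _ => .var _)))
  have hNclosed : IsClosed N := by
    have : N = ⋂ x' : Fin m → F, S ∩ (fun x => nrm (g x - y)) ⁻¹' Iic 1 ∩
        {x | x' ∈ S → nrm (g x' - y) < nrm (g x - y) → nrm x ≤ nrm x'} := by
      ext x
      simp only [hNdef, mem_iInter]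
      exact ⟨fun h x' => ⟨h.1, h.2 x'⟩, fun h => ⟨(h 0).1, fun x' => (h x').2⟩⟩
    rw [this]
    refine isClosed_iInter fun x' => ?_
    have h1 : IsClosed (S ∩ (fun x => nrm (g x - y)) ⁻¹' Iic 1) :=
      hdcont.preimage_isClosed_of_isClosed hclosed isClosed_Iic
    by_cases hx' : x' ∈ S
    · have h2 : IsClosed ((S ∩ (fun x => nrm (g x - y)) ⁻¹' Iic (nrm (g x' - y))) ∪
          {x | nrm x ≤ nrm x'}) :=
        (hdcont.preimage_isClosed_of_isClosed hclosed isClosed_Iic).union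
          (isClosed_le continuous_nrm continuous_const)
      convert h1.inter h2 using 1
      ext x
      simp only [mem_inter_iff, mem_preimage, mem_Iic, mem_union]
      constructor
      · rintro ⟨h, h'⟩
        refine ⟨h, ?_⟩
        by_cases hlt : nrm (g x' - y) < nrm (g x - y)
        · exact Or.inr (h' hx' hlt)
        · exact Or.inl ⟨h.1, not_lt.1 hlt⟩
      · rintro ⟨h, h'⟩
        exact ⟨h, fun _ hlt => h'.resolve_left fun h'' => hlt.not_ge h''.2⟩
    · convert h1 using 1
      ext x
      simp only [mem_inter_iff]
      exact ⟨fun h => h.1, fun h => ⟨h, fun hx => absurd hx hx'⟩⟩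
  have hSne : ∀ t > 0, ∃ x ∈ S, nrm (g x - y) < t := fun t ht => by
    obtain ⟨c, hc, hct⟩ := mem_closure_iff_nrm.1 hy t ht
    obtain ⟨x, hx, rfl⟩ := hsurj (hCY hc)
    exact ⟨x, ⟨hx, hc⟩, hct⟩
  have hNne : ∀ t > 0, ∃ x ∈ N, nrm (g x - y) < t := fun t ht => by
    -- A point of least norm in `S` among those mapped within `min 1 (t / 2)` of `y` lies in `N`,
    -- since any point mapped nearer to `y` competes in the same minimum.
    have h2 : 0 < min 1 (t / 2) := lt_min one_pos (half_pos ht)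
    obtain ⟨x₀, hx₀, hx₀'⟩ := hSne _ h2
    obtain ⟨x, ⟨hxS, hxt⟩, hx⟩ := exists_nrm_le hexp hcomplete
      (S := S ∩ (fun x => nrm (g x - y)) ⁻¹' Iic (min 1 (t / 2)))
      (.and hS (.le hexp (hgy fun i => .var i) (.const _)))
      (hdcont.preimage_isClosed_of_isClosed hclosed isClosed_Iic) ⟨x₀, hx₀, hx₀'.le⟩
    refine ⟨x, ⟨⟨hxS, le_trans hxt (min_le_left _ _)⟩, fun x' hx' hlt =>
      hx x' ⟨hx', hlt.le.trans hxt⟩⟩, ?_⟩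
    exact (le_trans hxt (min_le_right _ _)).trans_lt (half_lt_self ht)
  have hNcont : ContinuousOn g N := hScont.mono fun x hx => hx.1.1
  have hBclosed : IsClosed (insert y (g '' N)) := by
    refine isClosed_iff_nrm.2 fun z hz => ?_
    by_contra hzB
    have hzy : 0 < nrm (z - y) := nrm_sub_pos.2 fun h => hzB (Or.inl h)
    set a := nrm (z - y) / 2 with ha
    have hapos : 0 < a := half_pos hzy
    -- Being mapped nearer to `y` than `a`, `x₀` bounds the norm of every point of `N` mapped at
    -- distance at least `a`.
    obtain ⟨x₀, hx₀, hx₀'⟩ := hSne a hapos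
    have hNa : IsClosed (N ∩ (fun x => nrm (g x - y)) ⁻¹' Ici a) :=
      (hdcont.mono fun x hx => hx.1.1).preimage_isClosed_of_isClosed hNclosed isClosed_Ici
    have himg := isClosed_image hexp hcomplete
      (S := N ∩ (fun x => nrm (g x - y)) ⁻¹' Ici a)
      (.and hN (.le hexp (.const _) (hgy fun i => .var i))) hNa
      (isBdd_iff.2 ⟨nrm x₀, fun x hx => hx.1.2 x₀ hx₀ (hx₀'.trans_le hx.2)⟩) hg
      (hNcont.mono inter_subset_left)
    have : z ∈ g '' (N ∩ (fun x => nrm (g x - y)) ⁻¹' Ici a) := by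
      refine isClosed_iff_nrm.1 himg z fun ε hε => ?_
      -- As `z` is at distance `2 * a` from `y`, points within `a` of `z` are at distance at least
      -- `a` from `y`.
      obtain ⟨b, hb, hbz⟩ := hz (min ε a) (lt_min hε hapos)
      have hba : a ≤ nrm (b - y) := by
        have h1 := nrm_sub_le z b y
        rw [nrm_sub_comm (x := z) (y := b)] at h1
        have h2 := hbz.trans_le (min_le_right _ _)
        linarith
      rcases hb with rfl | ⟨x, hx, rfl⟩
      · rw [nrm_sub_self] at hba
        exact absurd hba hapos.not_ge
      · exact ⟨_, ⟨x, ⟨hx, hba⟩, rfl⟩, hbz.trans_le (min_le_left _ _)⟩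
    obtain ⟨x, hx, rfl⟩ := this
    exact hzB (Or.inr ⟨x, hx.1, rfl⟩)
  have hBdef : IsDef L (insert y (g '' N)) := by
    have : IsDef L {z : Fin n → F | (∀ i, z i = y i) ∨ ∃ x : Fin m → F, x ∈ N ∧ ∀ i, g x i = z i} :=
      .or (.finAll fun i => .eq (.var _) (.const _)) (.exVec (.and (hN.mem fun _ => .var _)
        (.finAll fun i => .eq ((hg i).comp fun _ => .var _) (.var _))))
    convert this using 1
    ext z
    simp [funext_iff]
  have hBbdd : IsBdd (insert y (g '' N)) := by
    refine isBdd_iff.2 ⟨1 + nrm y, ?_⟩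
    rintro z (rfl | ⟨x, hx, rfl⟩)
    · linarith
    · exact (nrm_le_add (g x) y).trans (by gcongr; exact hx.1.2)
  have hBY : insert y (g '' N) ⊆ Y := by
    rintro z (rfl | ⟨x, hx, rfl⟩)
    exacts [hyY, hmaps hx.1.1.1]
  have hNbdd : IsBdd N := by
    obtain ⟨r, hr⟩ := isBdd_iff.1 (hproper _ hBY hBdef hBclosed hBbdd)
    exact isBdd_iff.2 ⟨r, fun x hx => hr x ⟨hx.1.1.1, Or.inr ⟨x, hx, rfl⟩⟩⟩
  obtain ⟨x, hx, rfl⟩ := isClosed_iff_nrm.1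
    (isClosed_image hexp hcomplete hN hNclosed hNbdd hg hNcont) y fun ε hε => by
      obtain ⟨x, hx, h⟩ := hNne ε hε
      exact ⟨_, ⟨x, hx, rfl⟩, h⟩
  exact hyC hx.1.1.2

end Compactness

/-! ### Right-hand germs of definable sets and functions. -/

section OneVariable

variable {L : FirstOrder.Language.{u, v}} {F : Type w} [L.Structure F] {n : ℕ}
  [Field F] [LinearOrder F] [IsStrictOrderedRing F] [TopologicalSpace F] [OrderTopology F]

theorem eventually_nhdsGT_iff {a : F} {P : F → Prop} :
    (∀ᶠ t in 𝓝[>] a, P t) ↔ ∃ δ, 0 < δ ∧ ∀ t, a < t → t < a + δ → P t := by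
  rw [Filter.Eventually, mem_nhdsGT_iff_exists_Ioo_subset]
  constructor
  · rintro ⟨b, hb, h⟩
    exact ⟨b - a, sub_pos.2 hb, fun t h1 h2 => h ⟨h1, by linarith⟩⟩
  · rintro ⟨δ, hδ, h⟩
    exact ⟨a + δ, lt_add_of_pos_right a hδ, fun t ht => h t ht.1 ht.2⟩

/-- A definable set contains or avoids some interval to the right of a given point. -/
theorem eventually_mem_or_notMem (hlocal : LocallyOMinimal L F) {S : Set F} (hS : IsDef₁ L S)
    (a : F) : (∀ᶠ t in 𝓝[>] a, t ∈ S) ∨ ∀ᶠ t in 𝓝[>] a, t ∉ S := by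
  obtain ⟨c, d, hc, hd, P, I, h⟩ := hlocal S hS a
  have hcd : ∀ᶠ t in 𝓝[>] a, t ∈ Ioo c d :=
    mem_nhdsWithin_of_mem_nhds (Ioo_mem_nhds hc hd)
  -- An interval with `p.1 ≤ a < p.2` covers the right germ at `a`; without one, each of the
  -- finitely many pieces misses that germ.
  by_cases hI : ∃ p ∈ I, p.1 ≤ a ∧ a < p.2
  · obtain ⟨p, hp, h1, h2⟩ := hI
    left
    filter_upwards [Ioo_mem_nhdsGT h2] with t ht
    have : t ∈ S ∩ Ioo c d := by
      rw [h]
      exact Or.inr (mem_biUnion (x := p) hp ⟨h1.trans_lt ht.1, ht.2⟩)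
    exact this.1
  · right
    have hP : ∀ᶠ t in 𝓝[>] a, ∀ p ∈ P, t ≠ p := by
      refine (Filter.eventually_all_finset P).2 fun p _ => ?_
      rcases lt_or_ge a p with hp | hp
      · filter_upwards [Ioo_mem_nhdsGT hp] with t ht using ht.2.ne
      · filter_upwards [self_mem_nhdsWithin] with t ht using (hp.trans_lt ht).ne'
    have hI' : ∀ᶠ t in 𝓝[>] a, ∀ p ∈ I, t ∉ Ioo p.1 p.2 := by
      refine (Filter.eventually_all_finset I).2 fun p hp => ?_
      rcases lt_or_ge a p.1 with h1 | h1
      · filter_upwards [Ioo_mem_nhdsGT h1] with t ht ht' using ht.2.not_gt ht'.1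
      · have h2 : p.2 ≤ a := not_lt.1 fun h2 => hI ⟨p, hp, h1, h2⟩
        filter_upwards [self_mem_nhdsWithin] with t ht ht' using
          (ht'.2.trans_le h2).not_gt ht
    filter_upwards [hcd, hP, hI'] with t h1 h2 h3 h4
    have h5 : t ∈ S ∩ Ioo c d := ⟨h4, h1⟩
    rw [h] at h5
    rcases h5 with h5 | h5
    · exact h2 t h5 rfl
    · obtain ⟨p, hp, h5⟩ := mem_iUnion₂.1 h5
      exact h3 p hp h5

/-- The limit is the supremum of the eventual strict lower bounds of `g`; by the germ dichotomy, a
value `z` above it satisfies `g t ≤ z` eventually. -/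
theorem exists_tendsto_nhdsGT (hexp : ExpandsOrderedField L F) (hcomplete : DefinablyComplete L F)
    (hlocal : LocallyOMinimal L F) {g : F → F} (hg : DefFun L fun x : Fin 1 → F => g (x 0))
    {a r : F} (hr : ∀ᶠ t in 𝓝[>] a, |g t| ≤ r) : ∃ l, Tendsto g (𝓝[>] a) (𝓝 l) := by
  let G : Set F := {v | ∃ δ, 0 < δ ∧ ∀ t, a < t → t < a + δ → v < g t}
  have hGmem : ∀ {v}, v ∈ G ↔ ∀ᶠ t in 𝓝[>] a, v < g t := eventually_nhdsGT_iff.symm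
  have hG : IsDef₁ L G :=
    isDef₁_iff.2 (.ex (.and (.lt hexp (.const _) (.var _)) (.all (.imp
      (.lt hexp (.const _) (.var _)) (.imp (.lt hexp (.var _) (.add hexp (.const _) (.var _)))
      (.lt hexp (.var _) (hg.comp₁ (.var _))))))))
  obtain ⟨l, hl⟩ := hcomplete.exists_isLUB G hG
    ⟨-r - 1, hGmem.2 (hr.mono fun t ht => by linarith [(abs_le.1 ht).1])⟩
    ⟨r, fun v hv => by
      obtain ⟨t, h1, h2⟩ := (hr.and (hGmem.1 hv)).exists
      exact h2.le.trans (abs_le.1 h1).2⟩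
  refine ⟨l, tendsto_order.2 ⟨fun b hb => ?_, fun b hb => ?_⟩⟩
  · obtain ⟨v, hv, hbv, -⟩ := hl.exists_between hb
    exact (hGmem.1 hv).mono fun t ht => hbv.trans ht
  · obtain ⟨z, hlz, hzb⟩ := exists_between hb
    have hS : IsDef₁ L {t | z < g t} := isDef₁_iff.2 (.lt hexp (.const _) (hg.comp₁ (.var _)))
    rcases eventually_mem_or_notMem hlocal hS a with h | h
    · exact absurd (hl.1 (hGmem.2 h)) hlz.not_ge
    · exact h.mono fun t ht => (not_lt.1 ht).trans_lt hzb

/-- An interval is not the union of an increasing definable family of sets none of which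
accumulates from the right at a point of the interval. -/
theorem exists_notMem_of_antitone (hexp : ExpandsOrderedField L F)
    (hcomplete : DefinablyComplete L F) (hlocal : LocallyOMinimal L F) {D : F → Set F}
    (hD : ∀ {ι : Type} {g h : (ι → F) → F}, DefFun L g → DefFun L h → IsDef L {v | g v ∈ D (h v)})
    (hanti : ∀ c c', 0 < c → c ≤ c' → D c' ⊆ D c) {p q : F} (hpq : p < q)
    (hsep : ∀ a ∈ Ico p q, ∀ c > 0, ∀ᶠ t in 𝓝[>] a, t ∉ D c) :
    ∃ x ∈ Ioo p q, ∀ c > 0, x ∉ D c := by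
  by_contra! hcon
  -- `R` consists of the points that come first after `p` in some `D c`.
  let R : Set F := {x | ∃ c, (0 < c ∧ x ∈ D c) ∧ ∀ t, p < t → t < x → t ∉ D c}
  have hR : IsDef₁ L R := isDef₁_iff.2 (.ex (.and (.and (.lt hexp (.const _) (.var _))
    (hD (.var _) (.var _))) (.all (.imp (.lt hexp (.const _) (.var _)) (.imp
    (.lt hexp (.var _) (.var _)) (.not (hD (.var _) (.var _))))))))
  rcases eventually_mem_or_notMem hlocal hR p with h | h
  · obtain ⟨δ, hδ, h⟩ := eventually_nhdsGT_iff.1 h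
    obtain ⟨s, hps, hs⟩ := exists_between (lt_min hpq (lt_add_of_pos_right p hδ))
    obtain ⟨c, ⟨hc, hsc⟩, -⟩ := h s hps (hs.trans_le (min_le_right _ _))
    have h1 : ∀ᶠ t in 𝓝[>] s, t ∈ D c := by
      filter_upwards [Ioo_mem_nhdsGT (hs.trans_le (min_le_right _ _))] with t ht
      obtain ⟨c', ⟨hc', htc'⟩, hmin⟩ := h t (hps.trans ht.1) ht.2
      -- Here all points just right of `p` are in `R`. If `c' < c`, then `s` would precede `t` in `D
      -- c'`; so every `t` slightly beyond `s` falls in the single set `D c`, which then accumulates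
      -- at `s`.
      rcases le_total c c' with hcc | hcc
      · exact hanti _ _ hc hcc htc'
      · exact absurd (hanti _ _ hc' hcc hsc) (hmin s hps ht.1)
    obtain ⟨t, h2, h3⟩ := (h1.and (hsep s ⟨hps.le, hs.trans_le (min_le_left _ _)⟩ c hc)).exists
    exact h3 h2
  · obtain ⟨δ, hδ, h⟩ := eventually_nhdsGT_iff.1 h
    obtain ⟨x₀, hpx, hx⟩ := exists_between (lt_min hpq (lt_add_of_pos_right p hδ))
    obtain ⟨c, hc, hxc⟩ := hcon x₀ ⟨hpx, hx.trans_le (min_le_left _ _)⟩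
    have hE : IsDef₁ L {t | p < t ∧ t ∈ D c} :=
      isDef₁_iff.2 (.and (.lt hexp (.const _) (.var _)) (hD (.var _) (.const _)))
    -- Here points just right of `p` avoid `R`. But non-accumulation from the right forces the
    -- infimum of `D c` beyond `p` to be attained, and that point is in `R`.
    obtain ⟨x, hglb⟩ := hcomplete.exists_isGLB _ hE ⟨x₀, hpx, hxc⟩ ⟨p, fun t ht => ht.1.le⟩
    have hxx₀ : x ≤ x₀ := hglb.1 ⟨hpx, hxc⟩
    have hpx' : p ≤ x := hglb.2 fun t ht => ht.1.le
    have hxE : p < x ∧ x ∈ D c := by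
      obtain ⟨η, hη, hout⟩ := eventually_nhdsGT_iff.1
        (hsep x ⟨hpx', hxx₀.trans_lt (hx.trans_le (min_le_left _ _))⟩ c hc)
      obtain ⟨t, ht, hxt, htη⟩ := hglb.exists_between (lt_add_of_pos_right x hη)
      rcases hxt.eq_or_lt with rfl | hlt
      · exact ht
      · exact absurd ht.2 (hout t hlt htη)
    exact h x hxE.1 (hxx₀.trans_lt (hx.trans_le (min_le_right _ _)))
      ⟨c, ⟨hc, hxE.2⟩, fun t hpt htx htc => (hglb.1 ⟨hpt, htc⟩).not_gt htx⟩

theorem continuousAt_iff_abs {g : F → F} {x : F} :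
    ContinuousAt g x ↔ ∀ c, 0 < c → ∃ δ, 0 < δ ∧ ∀ t, |t - x| < δ → |g t - g x| < c :=
  (nhds_basis_abs_sub_lt x).tendsto_iff (nhds_basis_abs_sub_lt (g x))

/-- A definable function that is bounded to the right of a point is continuous on some interval to
the right of this point. -/
theorem eventually_continuousAt (hexp : ExpandsOrderedField L F)
    (hcomplete : DefinablyComplete L F) (hlocal : LocallyOMinimal L F) {g : F → F}
    (hg : DefFun L fun x : Fin 1 → F => g (x 0)) {a r : F} (hr : ∀ᶠ t in 𝓝[>] a, |g t| ≤ r) :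
    ∀ᶠ t in 𝓝[>] a, ContinuousAt g t := by
  -- `D c` collects the points where `g` jumps by at least `c` at arbitrarily small distance. A
  -- right limit at `b` makes `g` vary by less than `c` on an interval right of `b`, so `D c` does
  -- not accumulate there.
  let D : F → Set F := fun c => {x | ∀ δ, 0 < δ → ∃ t, |t - x| < δ ∧ c ≤ |g t - g x|}
  have hD : ∀ {ι : Type} {k h : (ι → F) → F}, DefFun L k → DefFun L h →
      IsDef L {v | k v ∈ D (h v)} := fun hk hh =>
    .all (.imp (.lt hexp (.const _) (.var _)) (.ex (.and (.lt hexp (.abs hexp (.sub hexp (.var _)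
      ((hk.weaken _).weaken _))) (.var _)) (.le hexp ((hh.weaken _).weaken _) (.abs hexp
      (.sub hexp (hg.comp₁ (.var _)) (hg.comp₁ ((hk.weaken _).weaken _))))))))
  have hS : IsDef₁ L {x | ContinuousAt g x} := by
    simp only [continuousAt_iff_abs]
    exact isDef₁_iff.2 (.all (.imp (.lt hexp (.const _) (.var _)) (.ex (.and
      (.lt hexp (.const _) (.var _)) (.all (.imp (.lt hexp (.abs hexp (.sub hexp (.var _) (.var _)))
      (.var _)) (.lt hexp (.abs hexp (.sub hexp (hg.comp₁ (.var _)) (hg.comp₁ (.var _))))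
      (.var _))))))))
  refine (eventually_mem_or_notMem hlocal hS a).resolve_right fun h => ?_
  obtain ⟨δ, hδ, h⟩ := eventually_nhdsGT_iff.1 (h.and hr)
  obtain ⟨p, hap, hp⟩ := exists_between (lt_add_of_pos_right a hδ)
  obtain ⟨x, hx, hxD⟩ := exists_notMem_of_antitone hexp hcomplete hlocal hD
    (fun c c' _ hcc x hx δ hδ => (hx δ hδ).imp fun t ht => ⟨ht.1, hcc.trans ht.2⟩) hp
    (fun b hb c hc => by
      obtain ⟨l, hl⟩ := exists_tendsto_nhdsGT hexp hcomplete hlocal hg (a := b) (r := r) <| by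
        filter_upwards [Ioo_mem_nhdsGT hb.2] with t ht
        exact (h t (hap.trans_le (hb.1.trans ht.1.le)) ht.2).2
      have hl' : ∀ᶠ t in 𝓝[>] b, |g t - l| < c / 2 :=
        hl ((nhds_basis_abs_sub_lt l).mem_of_mem (half_pos hc))
      obtain ⟨η, hη, hlη⟩ := eventually_nhdsGT_iff.1 hl'
      refine eventually_nhdsGT_iff.2 ⟨η, hη, fun x hbx hxη hxD => ?_⟩
      -- The radius keeps `t` inside `(b, b + η)`.
      obtain ⟨t, htx, ht⟩ := hxD (min (x - b) (b + η - x))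
        (lt_min (sub_pos.2 hbx) (sub_pos.2 hxη))
      obtain ⟨h1, h2⟩ := lt_min_iff.1 htx
      rw [abs_lt] at h1 h2
      have h3 := hlη t (by linarith) (by linarith)
      have h4 := hlη x hbx hxη
      have h5 := abs_sub_le (g t) l (g x)
      rw [abs_sub_comm l] at h5
      linarith)
  refine (h x (hap.trans hx.1) hx.2).1 (continuousAt_iff_abs.2 fun c hc => ?_)
  have := hxD c hc
  simp only [D, mem_ofPred_eq] at this
  push Not at this
  exact this

/-! ### Definable choice for bounded families. -/

/-- The relation that selects an element `p` of a bounded nonempty definable subset of `F`: its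
minimum if there is one, and otherwise the midpoint of its leftmost interval. -/
def Selects (S : Set F) (p : F) : Prop :=
  IsLeast S p ∨ ∃ r b, (r ∉ S ∧ IsGLB S r) ∧ IsLUB {z | Ioo r z ⊆ S} b ∧ p + p = r + b

theorem Selects.unique {S : Set F} {p p' : F} (h : Selects S p) (h' : Selects S p') : p = p' := by
  rcases h with h | ⟨r, b, ⟨hr, hrS⟩, hb, hp⟩ <;> rcases h' with h' | ⟨r', b', ⟨hr', hrS'⟩, hb', hp'⟩
  · exact h.unique h'
  · exact absurd (h.isGLB.unique hrS' ▸ h.1) hr'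
  · exact absurd (h'.isGLB.unique hrS ▸ h'.1) hr
  · obtain rfl := hrS.unique hrS'
    obtain rfl := hb.unique hb'
    linarith

/-- If the infimum `r` is not attained, the germ dichotomy puts an interval right of `r` inside the
set; boundedness above makes the largest such interval finite, with its midpoint in the set. -/
theorem exists_selects (hexp : ExpandsOrderedField L F) (hcomplete : DefinablyComplete L F)
    (hlocal : LocallyOMinimal L F) {S : Set F} (hS : IsDef₁ L S) (hne : S.Nonempty)
    (hbelow : BddBelow S) (habove : BddAbove S) : ∃ p ∈ S, Selects S p := by
  obtain ⟨r, hr⟩ := hcomplete.exists_isGLB S hS hne hbelow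
  by_cases hrS : r ∈ S
  · exact ⟨r, hrS, Or.inl ⟨hrS, hr.1⟩⟩
  have hev : ∀ᶠ t in 𝓝[>] r, t ∈ S := by
    refine (eventually_mem_or_notMem hlocal hS r).resolve_right fun h => ?_
    obtain ⟨δ, hδ, h⟩ := eventually_nhdsGT_iff.1 h
    obtain ⟨t, ht, hrt, htδ⟩ := hr.exists_between (lt_add_of_pos_right r hδ)
    rcases hrt.eq_or_lt with rfl | hlt
    · exact hrS ht
    · exact h t hlt htδ ht
  obtain ⟨δ, hδ, h⟩ := eventually_nhdsGT_iff.1 hev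
  have hE : IsDef₁ L {z | Ioo r z ⊆ S} := by
    have : IsDef₁ L {z | ∀ t, (r < t ∧ t < z) → t ∈ S} := isDef₁_iff.2 (.all (.imp (.and
      (.lt hexp (.const _) (.var _)) (.lt hexp (.var _) (.var _))) (IsDef.mem₁ hS (.var _))))
    exact this
  have hEmem : r + δ ∈ {z | Ioo r z ⊆ S} := fun t ht => h t ht.1 ht.2
  obtain ⟨M, hM⟩ := habove
  have hrM : r ≤ M := hne.elim fun s hs => (hr.1 hs).trans (hM hs)
  obtain ⟨b, hb⟩ := hcomplete.exists_isLUB _ hE ⟨_, hEmem⟩ ⟨M, fun z hz => by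
    by_contra! hMz
    obtain ⟨t, h1, h2⟩ := exists_between hMz
    exact (hM (hz ⟨hrM.trans_lt h1, h2⟩)).not_gt h1⟩
  have hrb : r < b := (lt_add_of_pos_right r hδ).trans_le (hb.1 hEmem)
  refine ⟨(r + b) / 2, ?_, Or.inr ⟨r, b, ⟨hrS, hr⟩, hb, add_halves _⟩⟩
  obtain ⟨z, hz, h1, -⟩ := hb.exists_between (show (r + b) / 2 < b by linarith)
  exact hz ⟨by linarith, h1⟩

theorem isDef_selects (hexp : ExpandsOrderedField L F) {ι : Type*} {S : (ι → F) → Set F}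
    (hS : IsDef L {w : ι ⊕ Fin 1 → F | w (Sum.inr 0) ∈ S fun i => w (Sum.inl i)})
    {g : (ι → F) → F} (hg : DefFun L g) : IsDef L {v | Selects (S v) (g v)} := by
  have hS' : ∀ {κ : Type _} (e : ι → κ) (j : κ), IsDef L {w : κ → F | w j ∈ S fun i => w (e i)} :=
    fun e j => hS.preimage_comp (Sum.elim e fun _ => j)
  have hSg : IsDef L {v | g v ∈ S v} := by
    have : IsDef L {v | ∃ p, g v = p ∧ p ∈ S v} :=
      .ex (.and (.eq (hg.weaken _) (.var _)) hS)
    simpa using this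
  refine .or ?_ ?_
  · exact .and hSg (.all (.imp (hS' _ _) (.le hexp (hg.weaken _) (.var _))))
  · refine .ex (.ex (.and (.and (.not (hS' _ _)) (.and ?_ ?_)) (.and (.and ?_ ?_) (.eq (.add hexp
      ((hg.weaken _).weaken _) ((hg.weaken _).weaken _)) (.add hexp (.var _) (.var _))))))
    · exact .all (.imp (hS' _ _) (.le hexp (.var _) (.var _)))
    · exact .all (.imp (.all (.imp (hS' _ _) (.le hexp (.var _) (.var _))))
        (.le hexp (.var _) (.var _)))
    · exact .all (.imp (.all (.imp (.and (.lt hexp (.var _) (.var _)) (.lt hexp (.var _) (.var _)))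
        (hS' _ _))) (.le hexp (.var _) (.var _)))
    · exact .all (.imp (.all (.imp (.all (.imp (.and (.lt hexp (.var _) (.var _))
        (.lt hexp (.var _) (.var _))) (hS' _ _))) (.le hexp (.var _) (.var _))))
        (.le hexp (.var _) (.var _)))

/-- The family is thinned coordinate by coordinate, keeping the points whose coordinate `i` is the
selected element of the projection. When `s` is everything, each nonempty fibre is a singleton. -/
theorem exists_choice_finset (hexp : ExpandsOrderedField L F) (hcomplete : DefinablyComplete L F)
    (hlocal : LocallyOMinimal L F) {U : F → Set (Fin n → F)} (hU : DefFamily L U)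
    (hne : ∀ t > 0, (U t).Nonempty) (hbdd : ∀ t > 0, IsBdd (U t)) (s : Finset (Fin n)) :
    ∃ V : F → Set (Fin n → F), DefFamily L V ∧ (∀ t, V t ⊆ U t) ∧ (∀ t > 0, (V t).Nonempty) ∧
      ∀ t, ∀ a ∈ V t, ∀ b ∈ V t, ∀ i ∈ s, a i = b i := by
  classical
  induction s using Finset.induction_on with
  | empty => exact ⟨U, hU, fun _ => Subset.rfl, hne, by simp⟩
  | insert i s hi ih =>
    obtain ⟨V, hV, hVU, hVne, hVs⟩ := ih
    refine ⟨fun t => {c | c ∈ V t ∧ Selects {z | ∃ c' : Fin n → F, c' ∈ V t ∧ c' i = z} (c i)},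
      ?_, fun t c hc => hVU t hc.1, fun t ht => ?_, ?_⟩
    · refine .and hV (isDef_selects hexp
        (S := fun w => {z | ∃ c' : Fin n → F, c' ∈ V (w (Sum.inl 0)) ∧ c' i = z})
        (.exVec (.and (hV.mem (.var _) fun _ => .var _) (.eq (.var _) (.var _)))) (.var _))
    · obtain ⟨r, hr⟩ := hbdd t ht
      have hdef : IsDef₁ L {z | ∃ c' : Fin n → F, c' ∈ V t ∧ c' i = z} :=
        isDef₁_iff.2 (.exVec (.and (hV.mem (.const _) fun _ => .var _) (.eq (.var _) (.var _))))
      obtain ⟨_, ⟨c, hc, rfl⟩, hsel⟩ := exists_selects hexp hcomplete hlocal hdef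
        ((hVne t ht).imp' (fun c => c i) fun c hc => ⟨c, hc, rfl⟩)
        ⟨-r, by rintro _ ⟨c, hc, rfl⟩; exact (abs_le.1 (hr c (hVU t hc) i)).1⟩
        ⟨r, by rintro _ ⟨c, hc, rfl⟩; exact (abs_le.1 (hr c (hVU t hc) i)).2⟩
      exact ⟨c, hc, hsel⟩
    · intro t a ha b hb j hj
      rcases Finset.mem_insert.1 hj with rfl | hj
      · exact ha.2.unique hb.2
      · exact hVs t a ha.1 b hb.1 j hj

/-- Definable choice for families of nonempty bounded sets. -/
theorem exists_choice (hexp : ExpandsOrderedField L F) (hcomplete : DefinablyComplete L F)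
    (hlocal : LocallyOMinimal L F) {U : F → Set (Fin n → F)} (hU : DefFamily L U)
    (hne : ∀ t > 0, (U t).Nonempty) (hbdd : ∀ t > 0, IsBdd (U t)) :
    ∃ c : F → Fin n → F, (∀ i, DefFun L fun x : Fin 1 → F => c (x 0) i) ∧
      ∀ t > 0, c t ∈ U t := by
  classical
  obtain ⟨V, hV, hVU, hVne, hVs⟩ :=
    exists_choice_finset hexp hcomplete hlocal hU hne hbdd Finset.univ
  choose! c hc using hVne
  -- Uniqueness in `V t` makes the chosen function definable for `t > 0`; the value 0 elsewhere
  -- makes it definable on all of `F`.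
  refine ⟨fun t => if 0 < t then c t else 0, fun i => ?_, fun t ht => ?_⟩
  · refine .of_iff (R := fun x z => (0 < x 0 ∧ ∃ a : Fin n → F, a ∈ V (x 0) ∧ a i = z) ∨
      (¬ 0 < x 0 ∧ 0 = z)) (fun x z => ?_) ?_
    · by_cases hx : 0 < x 0
      · simp only [hx, if_true, true_and, not_true, false_and, or_false]
        exact ⟨fun h => ⟨_, hc _ hx, h⟩, fun ⟨a, ha, h⟩ =>
          (hVs _ _ (hc _ hx) _ ha i (Finset.mem_univ i)).trans h⟩
      · simp [hx]
    · exact .or (.and (.lt hexp (.const _) (.var _)) (.exVec (.and (hV.mem (.var _) fun _ => .var _)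
        (.eq (.var _) (.var _))))) (.and (.not (.lt hexp (.const _) (.var _)))
        (.eq (.const _) (.var _)))
  · simp only [ht, if_true]
    exact hVU t (hc t ht)

end OneVariable

/-! ### From identifying to proper. -/

section Main

variable {L : FirstOrder.Language.{u, v}} {F : Type w} [L.Structure F] {m n : ℕ}
  [Field F] [LinearOrder F] [IsStrictOrderedRing F] [TopologicalSpace F] [OrderTopology F]

/-- The least norm of the points in a fibre of an identifying map is locally bounded. -/
theorem exists_locally_bounded_of_identifying (hexp : ExpandsOrderedField L F)
    (hcomplete : DefinablyComplete L F) (hlocal : LocallyOMinimal L F)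
    {X : Set (Fin m → F)} {Y : Set (Fin n → F)} (hX : IsDef L X) (hY : IsDef L Y)
    (hclosed : IsClosed X) {g : (Fin m → F) → Fin n → F} (hg : ∀ i, DefFun L fun x => g x i)
    (hcont : ContinuousOn g X) (hsurj : SurjOn g X Y)
    (hid : ∀ C ⊆ Y, IsDef L C → IsClosed {x | x ∈ X ∧ g x ∈ C} → ∀ y ∈ Y, y ∈ closure C → y ∈ C)
    {y : Fin n → F} (hy : y ∈ Y) :
    ∃ t > 0, ∀ c ∈ Y, nrm (c - y) < t → ∃ x ∈ X, g x = c ∧ nrm x * t ≤ 1 := by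
  by_contra! hcon
  -- Bad points near `y`: all their preimages have norm above `1/t`, written as a product to cover
  -- every `t`.
  let U : F → Set (Fin n → F) := fun t => {c | (c ∈ Y ∧ nrm (c - y) < t) ∧
    ∀ x : Fin m → F, x ∈ X → (∀ i, g x i = c i) → 1 < nrm x * t}
  have hU : DefFamily L U := by
    refine .and (.and (hY.mem fun _ => .var _) (.lt hexp (.nrm hexp fun i =>
      .sub hexp (.var _) (.const _)) (.var _))) (.allVec (.imp (hX.mem fun _ => .var _) (.imp
      (.finAll fun i => .eq ((hg i).comp fun _ => .var _) (.var _)) (.lt hexp (.const _)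
      (.mul hexp (.nrm hexp fun _ => .var _) (.var _))))))
  have hUbdd : ∀ t, ∀ c ∈ U t, nrm c ≤ t + nrm y := fun t c hc =>
    (nrm_le_add c y).trans (by gcongr; exact hc.1.2.le)
  obtain ⟨c, hc, hcU⟩ := exists_choice hexp hcomplete hlocal hU
    (fun t ht => by
      obtain ⟨c, hc, hct, h⟩ := hcon t ht
      exact ⟨c, ⟨hc, hct⟩, fun x hx hxc => h x hx (funext hxc)⟩)
    (fun t ht => isBdd_iff.2 ⟨_, hUbdd t⟩)
  have hev : ∀ᶠ t in 𝓝[>] (0 : F), ∀ i, ContinuousAt (fun t => c t i) t := by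
    refine eventually_all.2 fun i =>
      eventually_continuousAt hexp hcomplete hlocal (hc i) (r := 1 + nrm y) ?_
    filter_upwards [Ioo_mem_nhdsGT (one_pos : (0 : F) < 1)] with t ht
    refine (abs_le_nrm i).trans ((hUbdd t _ (hcU t ht.1)).trans ?_)
    gcongr
    exact ht.2.le
  obtain ⟨δ, hδ, hδc⟩ := eventually_nhdsGT_iff.1 hev
  obtain ⟨x₀, hx₀, hx₀y⟩ := hsurj hy
  have hpos : ∀ x : Fin m → F, 0 < nrm x + 1 := fun x => by linarith [nrm_nonneg (x := x)]
  -- Below `δ` the curve is continuous; below `(nrm x₀ + 1)⁻¹` it cannot pass through `y`, whose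
  -- preimage `x₀` has too small a norm.
  obtain ⟨ε, hε, hεδ⟩ := exists_between (lt_min hδ (inv_pos.2 (hpos x₀)))
  obtain ⟨hεδ, hεx⟩ := lt_min_iff.1 hεδ
  have hUlt : ∀ x ∈ X, ∀ t, 0 < t → g x = c t → 1 < nrm x * t := fun x hx t ht hxt =>
    (hcU t ht).2 x hx fun i => congrFun hxt i
  set C : Set (Fin n → F) := {z | ∃ t, (0 < t ∧ t ≤ ε) ∧ ∀ i, c t i = z i} with hCdef
  have hCmem : ∀ {t}, 0 < t → t ≤ ε → c t ∈ C := fun h1 h2 => ⟨_, ⟨h1, h2⟩, fun _ => rfl⟩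
  have hC : IsDef L C := .ex (.and (.and (.lt hexp (.const _) (.var _))
    (.le hexp (.var _) (.const _))) (.finAll fun i => .eq ((hc i).comp fun _ => .var _) (.var _)))
  have hCY : C ⊆ Y := by
    rintro z ⟨t, ht, hz⟩
    rw [← funext hz]
    exact (hcU t ht.1).1.1
  have hCclosed : IsClosed {x | x ∈ X ∧ g x ∈ C} := by
    refine isClosed_iff_nrm.2 fun x hx => ?_
    have hxX : x ∈ X := isClosed_iff_nrm.1 hclosed x fun η hη =>
      (hx η hη).imp fun x' h => ⟨h.1.1, h.2⟩
    refine ⟨hxX, ?_⟩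
    -- Points of `X` within 1 of `x` have norm below `nrm x + 1`, so they can map to `c t` only for
    -- `t ≥ (nrm x + 1)⁻¹`. The curve over this closed interval has closed image.
    have himg : IsClosed ((fun s : Fin 1 → F => c (s 0)) ''
        {s | (nrm x + 1)⁻¹ ≤ s 0 ∧ s 0 ≤ ε}) := by
      refine isClosed_image hexp hcomplete
        (.and (.le hexp (.const _) (.var _)) (.le hexp (.var _) (.const _)))
        ((isClosed_le continuous_const (continuous_apply 0)).inter
          (isClosed_le (continuous_apply 0) continuous_const))
        ⟨ε, fun s hs i => ?_⟩ hc ?_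
      · rw [Subsingleton.elim i 0, abs_of_nonneg ((inv_pos.2 (hpos x)).le.trans hs.1)]
        exact hs.2
      · refine continuousOn_pi.2 fun i s hs => ContinuousAt.continuousWithinAt ?_
        exact ContinuousAt.comp (f := fun s : Fin 1 → F => s 0) (g := fun t => c t i)
          (hδc _ ((inv_pos.2 (hpos x)).trans_le hs.1) (by linarith [hs.2]) i)
          (continuous_apply 0).continuousAt
    have : g x ∈ (fun s : Fin 1 → F => c (s 0)) '' {s | (nrm x + 1)⁻¹ ≤ s 0 ∧ s 0 ≤ ε} := by
      refine isClosed_iff_nrm.1 himg _ fun η hη => ?_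
      obtain ⟨θ, hθ, h⟩ := continuousOn_iff_nrm.1 hcont x hxX η hη
      obtain ⟨x', ⟨hx'X, t, ⟨ht, htε⟩, hxt⟩, hx'⟩ := hx (min θ 1) (lt_min hθ one_pos)
      refine ⟨g x', ⟨fun _ => t, ⟨?_, htε⟩, funext hxt⟩, h x' hx'X (hx'.trans_le (min_le_left _ _))⟩
      have h1 := hUlt x' hx'X t ht (funext hxt).symm
      have h2 := nrm_le_add x' x
      have h3 := hx'.trans_le (min_le_right _ _)
      rw [inv_le_iff_one_le_mul₀' (hpos x)]
      refine h1.le.trans (mul_le_mul_of_nonneg_right (by linarith) ht.le)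
    obtain ⟨s, hs, hsx⟩ := this
    rw [← hsx]
    exact hCmem ((inv_pos.2 (hpos x)).trans_le hs.1) hs.2
  have hyC : y ∈ closure C := by
    refine mem_closure_iff_nrm.2 fun η hη => ?_
    have h : 0 < min ε η := lt_min hε hη
    exact ⟨_, hCmem h (min_le_left _ _), (hcU _ h).1.2.trans_le (min_le_right _ _)⟩
  obtain ⟨t, ⟨ht, htε⟩, hty⟩ := hid C hCY hC hCclosed y hy hyC
  have h1 := hUlt x₀ hx₀ t ht (hx₀y.trans (funext hty).symm)
  have h2 := htε.trans_lt hεx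
  rw [← one_div, lt_div_iff₀ (hpos x₀)] at h2
  linarith

theorem exists_proper_of_identifying (hexp : ExpandsOrderedField L F)
    (hcomplete : DefinablyComplete L F) (hlocal : LocallyOMinimal L F)
    {X : Set (Fin m → F)} {Y : Set (Fin n → F)} (hX : IsDef L X) (hY : IsDef L Y)
    (hclosed : IsClosed X) {g : (Fin m → F) → Fin n → F} (hg : ∀ i, DefFun L fun x => g x i)
    (hcont : ContinuousOn g X) (hmaps : MapsTo g X Y) (hsurj : SurjOn g X Y)
    (hid : ∀ C ⊆ Y, IsDef L C → IsClosed {x | x ∈ X ∧ g x ∈ C} →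
      ∀ y ∈ Y, y ∈ closure C → y ∈ C) :
    ∃ K ⊆ X, IsDef L K ∧ IsClosed K ∧ SurjOn g K Y ∧
      ∀ B ⊆ Y, IsDef L B → IsClosed B → IsBdd B → IsBdd {x | x ∈ K ∧ g x ∈ B} := by
  -- `K₀` need not be closed. Its closure still serves, because each of its points has points of
  -- `K₀` nearby in norm and in image.
  set K₀ : Set (Fin m → F) := {x | x ∈ X ∧
    ∀ x' : Fin m → F, x' ∈ X → (∀ i, g x' i = g x i) → nrm x ≤ nrm x'} with hK₀def
  have hK₀ : IsDef L K₀ := .and hX (.allVec (.imp (hX.mem fun _ => .var _) (.imp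
    (.finAll fun i => .eq ((hg i).comp fun _ => .var _) ((hg i).comp fun _ => .var _))
    (.le hexp (.nrm hexp fun _ => .var _) (.nrm hexp fun _ => .var _)))))
  have hK₀X : K₀ ⊆ X := fun x hx => hx.1
  have hKX : closure K₀ ⊆ X := closure_minimal hK₀X hclosed
  have hK : IsDef L (closure K₀) := by
    have : IsDef L {a : Fin m → F | ∀ ε, 0 < ε → ∃ x : Fin m → F, x ∈ K₀ ∧ nrm (x - a) < ε} :=
      .all (.imp (.lt hexp (.const _) (.var _)) (.exVec (.and (hK₀.mem fun _ => .var _)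
        (.lt hexp (.nrm hexp fun i => .sub hexp (.var _) (.var _)) (.var _)))))
    convert! this using 1
    ext a
    exact mem_closure_iff_nrm
  refine ⟨closure K₀, hKX, hK, isClosed_closure, fun y hy => ?_, fun B hBY hB hBclosed hBbdd => ?_⟩
  · obtain ⟨x₀, hx₀, hx₀y⟩ := hsurj hy
    have hfib : IsDef L (X ∩ g ⁻¹' {y}) := by
      have : IsDef L {x | x ∈ X ∧ ∀ i, g x i = y i} :=
        .and hX (.finAll fun i => .eq (hg i) (.const _))
      convert this using 1
      ext x
      simp [funext_iff]
    obtain ⟨x, ⟨hx, hxy⟩, hmin⟩ := exists_nrm_le hexp hcomplete hfib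
      (hcont.preimage_isClosed_of_isClosed hclosed isClosed_singleton) ⟨x₀, hx₀, hx₀y⟩
    exact ⟨x, subset_closure ⟨hx, fun x' hx' h => hmin x' ⟨hx', (funext h).trans hxy⟩⟩, hxy⟩
  · by_contra hcon
    -- Images in `B` of points of `K` with norm at least `1/t`; unboundedness makes every `A t`
    -- nonempty, and they cluster at some `y ∈ B`.
    let A : F → Set (Fin n → F) := fun t => {b | b ∈ B ∧
      ∃ x : Fin m → F, x ∈ closure K₀ ∧ (∀ i, g x i = b i) ∧ 1 ≤ nrm x * t}
    have hA : DefFamily L A := .and (hB.mem fun _ => .var _) (.exVec (.and (hK.mem fun _ => .var _)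
      (.and (.finAll fun i => .eq ((hg i).comp fun _ => .var _) (.var _)) (.le hexp (.const _)
      (.mul hexp (.nrm hexp fun _ => .var _) (.var _))))))
    obtain ⟨y, hyB, hy⟩ := exists_cluster_mem hexp hcomplete hA
      (fun s t _ hst b hb => ⟨hb.1, hb.2.imp fun x hx => ⟨hx.1, hx.2.1,
        hx.2.2.trans (mul_le_mul_of_nonneg_left hst nrm_nonneg)⟩⟩)
      (fun t ht => by
        by_contra! hempty
        refine hcon (isBdd_iff.2 ⟨t⁻¹, fun x hx => ?_⟩)
        by_contra! hlt
        have hmem : g x ∈ A t := ⟨hx.2, x, hx.1, fun _ => rfl, ((inv_lt_iff_one_lt_mul₀ ht).1 hlt).le⟩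
        exact (hempty ▸ hmem : g x ∈ (∅ : Set (Fin n → F))))
      one_pos (isBdd_iff.2 ((isBdd_iff.1 hBbdd).imp fun r hr b hb => hr b hb.1)) hBclosed
      (fun t _ b hb => hb.1)
    obtain ⟨t, ht, hbound⟩ := exists_locally_bounded_of_identifying hexp hcomplete hlocal hX hY
      hclosed hg hcont hsurj hid (hBY hyB)
    -- With `t / 2`, `x` has norm at least `2/t`. A point `x' ∈ K₀` within `1/t` of `x` and mapped
    -- within `t` of `y` has norm at most `1/t` by minimality, forcing `nrm x < 2/t`.
    obtain ⟨b, ⟨-, x, hx, hxb, hxt⟩, hby⟩ := hy (t / 2) (half_pos ht)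
    obtain rfl : g x = b := funext hxb
    obtain ⟨δ, hδ, hδg⟩ := continuousOn_iff_nrm.1 hcont x (hKX hx) _ (half_pos ht)
    obtain ⟨x', hx', hxx'⟩ := mem_closure_iff_nrm.1 hx (min δ t⁻¹) (lt_min hδ (inv_pos.2 ht))
    have h1 := hδg x' hx'.1 (hxx'.trans_le (min_le_left _ _))
    have h2 := hxx'.trans_le (min_le_right _ _)
    rw [← one_div, lt_div_iff₀ ht, nrm_sub_comm] at h2
    obtain ⟨x'', hx'', hgx, hle⟩ := hbound (g x') (hmaps hx'.1)
      ((nrm_sub_le _ (g x) _).trans_lt (by linarith))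
    have h3 := mul_le_mul_of_nonneg_right (hx'.2 x'' hx'' (congrFun hgx)) ht.le
    have h4 := mul_le_mul_of_nonneg_right (nrm_le_add x x') ht.le
    linarith

end Main

/-! ### Passage from maps of subtypes to total functions. -/

section Extension

variable {L : FirstOrder.Language.{u, v}} {F : Type w} [L.Structure F] {m n : ℕ} [Zero F]
  {X : Set (Fin m → F)} {Y : Set (Fin n → F)}

open Classical in
/-- The extension of a map by zero. -/
noncomputable def extendZero (f : X → Y) (x : Fin m → F) : Fin n → F :=
  if h : x ∈ X then f ⟨x, h⟩ else 0

theorem extendZero_coe (f : X → Y) (x : X) : extendZero f x = f x := by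
  simp [extendZero]

theorem extendZero_of_mem (f : X → Y) {x : Fin m → F} (hx : x ∈ X) :
    extendZero f x = f ⟨x, hx⟩ :=
  extendZero_coe f ⟨x, hx⟩

theorem defFun_extendZero (hX : IsDef L X) {f : X → Y} (hf : IsDefMap L f) (i : Fin n) :
    DefFun L fun x => extendZero f x i := by
  refine .of_iff (R := fun x t => (∃ y : Fin n → F, Sum.elim x y ∈
    {p : Fin m ⊕ Fin n → F | ∃ x : X, p = Sum.elim (x : Fin m → F) (f x : Fin n → F)} ∧ y i = t) ∨
    (x ∉ X ∧ 0 = t)) (fun x t => ?_) ?_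
  · by_cases hx : x ∈ X
    · rw [extendZero_of_mem f hx]
      constructor
      · exact fun h => Or.inl ⟨_, ⟨⟨x, hx⟩, rfl⟩, h⟩
      · rintro (⟨y, ⟨x', h⟩, hy⟩ | ⟨h, -⟩)
        · have h1 : x = x' := funext fun j => congrFun h (Sum.inl j)
          have h2 : y = f x' := funext fun j => congrFun h (Sum.inr j)
          subst h1
          rwa [h2] at hy
        · exact absurd hx h
    · simp only [extendZero, hx, dite_false, not_false_eq_true, true_and, Pi.zero_apply]
      refine ⟨Or.inr, fun h => h.resolve_left ?_⟩
      rintro ⟨y, ⟨x', h⟩, -⟩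
      have : x = x' := funext fun j => congrFun h (Sum.inl j)
      exact hx (this ▸ x'.2)
  · refine .or (.exVec (.and (IsDef.mem (κ := Fin m ⊕ Fin n) hf ?_) (.eq (.var _) (.var _))))
      (.and (.not (hX.mem fun _ => .var _)) (.eq (.const _) (.var _)))
    rintro (j | j)
    exacts [.var _, .var _]

theorem continuousOn_extendZero [TopologicalSpace F] {f : X → Y} (hf : Continuous f) :
    ContinuousOn (extendZero f) X := by
  rw [continuousOn_iff_continuous_domRestrict]
  have : X.domRestrict (extendZero f) = fun x => (f x : Fin n → F) := funext (extendZero_coe f)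
  rw [this]
  exact continuous_subtype_val.comp hf

end Extension

theorem isClosed_setOf_subtype_iff {α : Type*} [TopologicalSpace α] {X : Set α} (hX : IsClosed X)
    {P : X → Prop} {Q : α → Prop} (h : ∀ x : X, P x ↔ Q x) :
    IsClosed {x : X | P x} ↔ IsClosed {x | x ∈ X ∧ Q x} := by
  rw [hX.isClosedEmbedding_subtypeVal.isClosed_iff_image_isClosed]
  refine iff_of_eq (congrArg _ ?_)
  ext x
  simp [h, and_comm]

theorem isClosed_setOf_coe_iff {α : Type*} [TopologicalSpace α] {Y C : Set α} :
    IsClosed {y : Y | (y : α) ∈ C} ↔ ∀ y ∈ Y, y ∈ closure (C ∩ Y) → y ∈ C := by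
  rw [← closure_subset_iff_isClosed]
  have : (fun y : Y => (y : α)) '' {y : Y | (y : α) ∈ C} = C ∩ Y := by
    ext y
    simp
  simp only [Set.subset_def, closure_subtype, this, Subtype.forall]
  rfl

end DefinableMaps

/-! ### The equivalence. -/

open DefinableMaps Set in
theorem mainTheorem7 (L : FirstOrder.Language.{u, v}) (F : Type w)
    [Field F] [LinearOrder F] [IsStrictOrderedRing F] [TopologicalSpace F] [OrderTopology F]
    [L.Structure F]
    (hexp : DefinableMaps.ExpandsOrderedField L F)
    (hcomplete : DefinableMaps.DefinablyComplete L F)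
    (hlocal : DefinableMaps.LocallyOMinimal L F)
    (m n : ℕ) (X : Set (Fin m → F)) (Y : Set (Fin n → F))
    (hXdef : DefinableMaps.IsDef L X) (hYdef : DefinableMaps.IsDef L Y)
    (hXclosed : IsClosed X)
    (f : X → Y) (hfdef : DefinableMaps.IsDefMap L f) (hfcont : Continuous f) :
    DefinableMaps.DefinablyIdentifying L f ↔
      ∃ (K : Set (Fin m → F)) (hKX : K ⊆ X), DefinableMaps.IsDef L K ∧ IsClosed K ∧
        Function.Surjective (fun x : K => f (Set.inclusion hKX x)) ∧
        DefinableMaps.DefinablyProper L (fun x : K => f (Set.inclusion hKX x)) := by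
  have hg := defFun_extendZero hXdef hfdef
  have hcont := continuousOn_extendZero hfcont
  have hmaps : MapsTo (extendZero f) X Y := fun x hx => by
    rw [extendZero_of_mem f hx]
    exact (f ⟨x, hx⟩).2
  have hpre : ∀ C : Set (Fin n → F), IsClosed {x : X | (f x : Fin n → F) ∈ C} ↔
      IsClosed {x | x ∈ X ∧ extendZero f x ∈ C} := fun C =>
    isClosed_setOf_subtype_iff hXclosed fun x => by rw [extendZero_coe]
  have hKpre : ∀ {K : Set (Fin m → F)} (hKX : K ⊆ X) (B : Set (Fin n → F)),
      {x : Fin m → F | ∃ hx : x ∈ K, (f (Set.inclusion hKX ⟨x, hx⟩) : Fin n → F) ∈ B} =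
        {x | x ∈ K ∧ extendZero f x ∈ B} := fun hKX B => by
    ext x
    constructor
    · rintro ⟨hx, h⟩
      exact ⟨hx, by rwa [extendZero_of_mem f (hKX hx)]⟩
    · rintro ⟨hx, h⟩
      exact ⟨hx, by rwa [extendZero_of_mem f (hKX hx)] at h⟩
  constructor
  · rintro ⟨hsurj, hid⟩
    obtain ⟨K, hKX, hK, hKclosed, hKsurj, hKproper⟩ := exists_proper_of_identifying hexp hcomplete
      hlocal hXdef hYdef hXclosed hg hcont hmaps
      (fun y hy => by
        obtain ⟨x, hx⟩ := hsurj ⟨y, hy⟩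
        exact ⟨x, x.2, by rw [extendZero_coe, hx]⟩)
      (fun C hCY hC hclosed y hy hyC => isClosed_setOf_coe_iff.1
        (hid C hCY hC ((hpre C).2 hclosed)) y hy (by rwa [inter_eq_left.2 hCY]))
    refine ⟨K, hKX, hK, hKclosed, fun y => ?_, fun B hBY hB hBclosed hBbdd => ?_⟩
    · obtain ⟨x, hx, hxy⟩ := hKsurj y.2
      rw [extendZero_of_mem f (hKX hx)] at hxy
      exact ⟨⟨x, hx⟩, Subtype.ext hxy⟩
    · rw [hKpre hKX]
      -- Closedness of the preimage is automatic from continuity, since `K` is closed in the ambient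
      -- space.
      exact ⟨hKproper B hBY hB hBclosed hBbdd,
        (hcont.mono hKX).preimage_isClosed_of_isClosed hKclosed hBclosed⟩
  · rintro ⟨K, hKX, hK, hKclosed, hKsurj, hKproper⟩
    refine ⟨fun y => (hKsurj y).imp' _ fun x hx => hx, fun C hCY hC hclosed => ?_⟩
    refine isClosed_setOf_coe_iff.2 fun y hy hyC => ?_
    rw [inter_eq_left.2 hCY] at hyC
    refine mem_of_mem_closure_of_proper hexp hcomplete hK hg (hcont.mono hKX)
      (hmaps.mono_left hKX) (fun y hy => ?_) (fun B hBY hB hBclosed hBbdd => ?_) hCY hC ?_ hy hyC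
    · obtain ⟨x, hx⟩ := hKsurj ⟨y, hy⟩
      exact ⟨x, x.2, by rw [extendZero_of_mem f (hKX x.2)]; exact congrArg Subtype.val hx⟩
    · have := (hKproper B hBY hB hBclosed hBbdd).1
      rwa [hKpre hKX] at this
    · convert hKclosed.inter ((hpre C).1 hclosed) using 1
      ext x
      exact ⟨fun h => ⟨h.1, hKX h.1, h.2⟩, fun h => ⟨h.1, h.2.2⟩⟩
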